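/- Let $n\ge 1$, $S\subseteq\{0,1\}^n$, and let $f:S\to\{0,1\}$ be a (partial, or if $S=\{0,1\}^n$ total) Boolean function. Let $p=\{p_x\}_{x\in S}$ range over all families of probability distributions $p_x$ on $[n]=\{1,\dots,n\}$, and define \[ \mathsf{sumPI}(f)=\min_{p}\ \max_{x,y\in S:\ f(x)\ne f(y)}\ \frac{1}{\sum_{i:\,x_i\ne y_i}\sqrt{p_x(i)\,p_y(i)}},\qquad \mathsf{maxPI}(f)=\min_{p}\ \max_{x,y\in S:\ f(x)\ne f(y)}\ \frac{1}{\max_{i:\,x_i\ne y_i}\sqrt{p_x(i)\,p_y(i)}}, \] with values in $[0,\infty]$, where $1/0=\infty$ and a maximum over the empty set (constant $f$) is $0$. Let $X=f^{-1}(0)$, $Y=f^{-1}(1)$, and let $R_f=\{(x,y,i)\in X\times Y\times[n] : x_i\ne y_i\}$ be the Karchmer--Wigderson relation. A rectangle $X'\times Y'$ with $X'\subseteq X$, $Y'\subseteq Y$ is monochromatic if there is an $i\in[n]$ with $(x,y,i)\in R_f$ for all $x\in X'$, $y\in Y'$. The rectangle partition number $C^D(R_f)$ is the smallest number of pairwise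 disjoint monochromatic rectangles whose union is $X\times Y$. A formula over $\{\vee,\wedge,\neg\}$ is a binary tree whose internal nodes are labeled by $\vee$ or $\wedge$ and whose leaves are labeled by literals $x_i$ or $\neg x_i$, $i\in[n]$; its size is its number of leaves. The formula size $L(f)$ is the smallest size of a formula that agrees with $f$ on all of $S$. Theorem. For every such $f$, \[ \mathsf{sumPI}(f)^2\ \le\ \mathsf{maxPI}(f)^2\ \le\ C^D(R_f)\ \le\ L(f). \] -/

import Mathlib

open scoped ENNReal

noncomputable section

namespace AdvFormula

/-- Boolean formulae over the standard basis in the variables indexed by `Fin n`: binary trees with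
inner nodes `and`, `or`, and leaves labelled by literals (`pos i` is a variable, `neg i` its
negation). -/
inductive Formula (n : ℕ) : Type
  | pos (i : Fin n) : Formula n
  | neg (i : Fin n) : Formula n
  | and (φ ψ : Formula n) : Formula n
  | or (φ ψ : Formula n) : Formula n

/-- The Boolean function computed by a formula. -/
def Formula.eval {n : ℕ} : Formula n → (Fin n → Bool) → Bool
  | .pos i, x => x i
  | .neg i, x => !(x i)
  | .and φ ψ, x => φ.eval x && ψ.eval x
  | .or φ ψ, x => φ.eval x || ψ.eval x

/-- The size of a formula is its number of leaves. -/
def Formula.size {n : ℕ} : Formula n → ℕ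
  | .pos _ => 1
  | .neg _ => 1
  | .and φ ψ => φ.size + ψ.size
  | .or φ ψ => φ.size + ψ.size

/-- A formula computes the (possibly partial) Boolean function `f : S → {0,1}` if it agrees with `f`
on all of `S`. -/
def Formula.Computes {n : ℕ} (φ : Formula n) {S : Set (Fin n → Bool)} (f : S → Bool) : Prop :=
  ∀ x : S, φ.eval x = f x

/-- The formula size `L(f)`: the least size of a formula computing `f`. -/
def formulaSize {n : ℕ} {S : Set (Fin n → Bool)} (f : S → Bool) : ℕ∞ :=
  ⨅ (φ : Formula n) (_ : φ.Computes f), (φ.size : ℕ∞)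

/-- A set of pairs is a monochromatic rectangle for the relation `R ⊆ X × Y × Z` if it has the form
`X' × Y'` and some `z` is a correct answer on all of `X' × Y'`. -/
def IsMonochromaticRectangle {X Y Z : Type*} (R : X → Y → Z → Prop) (Q : Set (X × Y)) : Prop :=
  ∃ (X' : Set X) (Y' : Set Y), Q = X' ×ˢ Y' ∧ ∃ z, ∀ x ∈ X', ∀ y ∈ Y', R x y z

/-- A finite set system of pairwise disjoint monochromatic rectangles covering `X × Y`. -/
def IsMonochromaticPartition {X Y Z : Type*} (R : X → Y → Z → Prop)
    (P : Finset (Set (X × Y))) : Prop :=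
  (∀ Q ∈ P, IsMonochromaticRectangle R Q) ∧
    (∀ Q ∈ P, ∀ Q' ∈ P, Q ≠ Q' → Disjoint Q Q') ∧
    (∀ a : X × Y, ∃ Q ∈ P, a ∈ Q)

/-- The rectangle partition number `C^D(R)`: the least number of pairwise disjoint monochromatic
rectangles required to cover `X × Y`. -/
def rectanglePartitionNumber {X Y Z : Type*} (R : X → Y → Z → Prop) : ℕ∞ :=
  ⨅ (P : Finset (Set (X × Y))) (_ : IsMonochromaticPartition R P), (P.card : ℕ∞)

/-- The Karchmer-Wigderson relation `R_f` on `f⁻¹(0) × f⁻¹(1) × [n]`. -/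
def kwRelation {n : ℕ} {S : Set (Fin n → Bool)} (f : S → Bool) :
    {x : S // f x = false} → {y : S // f y = true} → Fin n → Prop :=
  fun x y i => x.1.1 i ≠ y.1.1 i

/-- The objective `max_{f(x) ≠ f(y)} 1 / ∑_{i : x_i ≠ y_i} √(p_x(i) p_y(i))`, with values in
`[0, ∞]`, of a family `p` of probability distributions on `[n]`. -/
def sumPIObjective {n : ℕ} {S : Set (Fin n → Bool)} (f : S → Bool)
    (p : S → stdSimplex ℝ (Fin n)) : ℝ≥0∞ :=
  ⨆ (x : S) (y : S) (_ : f x ≠ f y),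
    (∑ i with x.1 i ≠ y.1 i, ENNReal.ofReal √((p x).1 i * (p y).1 i))⁻¹

/-- The objective `max_{f(x) ≠ f(y)} 1 / max_{i : x_i ≠ y_i} √(p_x(i) p_y(i))`, with values in
`[0, ∞]`, of a family `p` of probability distributions on `[n]`. -/
def maxPIObjective {n : ℕ} {S : Set (Fin n → Bool)} (f : S → Bool)
    (p : S → stdSimplex ℝ (Fin n)) : ℝ≥0∞ :=
  ⨆ (x : S) (y : S) (_ : f x ≠ f y),
    (⨆ (i : Fin n) (_ : x.1 i ≠ y.1 i), ENNReal.ofReal √((p x).1 i * (p y).1 i))⁻¹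

/-- `sumPI(f)`; for `0 < n` the infimum is a minimum, see `sumPI_attained`. -/
def sumPI {n : ℕ} {S : Set (Fin n → Bool)} (f : S → Bool) : ℝ≥0∞ :=
  ⨅ p : S → stdSimplex ℝ (Fin n), sumPIObjective f p

/-- `maxPI(f)`; for `0 < n` the infimum is a minimum, see `maxPI_attained`. -/
def maxPI {n : ℕ} {S : Set (Fin n → Bool)} (f : S → Bool) : ℝ≥0∞ :=
  ⨅ p : S → stdSimplex ℝ (Fin n), maxPIObjective f p

theorem continuous_term {n : ℕ} {S : Set (Fin n → Bool)} (x y : S) (i : Fin n) :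
    Continuous fun p : S → stdSimplex ℝ (Fin n) =>
      ENNReal.ofReal √((p x).1 i * (p y).1 i) := by
  refine ENNReal.continuous_ofReal.comp (Real.continuous_sqrt.comp ?_)
  have h (z : S) : Continuous fun p : S → stdSimplex ℝ (Fin n) => (p z).1 i :=
    (continuous_apply i).comp
      ((continuous_subtype_val (p := (· ∈ stdSimplex ℝ (Fin n)))).comp (continuous_apply z))
  exact (h x).mul (h y)

theorem exists_eq_iInf {n : ℕ} (hn : 0 < n) {S : Set (Fin n → Bool)}
    (F : (S → stdSimplex ℝ (Fin n)) → ℝ≥0∞) (hF : LowerSemicontinuous F) :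
    ∃ p, F p = ⨅ q, F q := by
  have : Nonempty (Fin n) := ⟨⟨0, hn⟩⟩
  have : CompactSpace (stdSimplex ℝ (Fin n)) :=
    isCompact_iff_compactSpace.mp (isCompact_stdSimplex ℝ (Fin n))
  have : Nonempty (stdSimplex ℝ (Fin n)) := ⟨⟨_, single_mem_stdSimplex ℝ ⟨0, hn⟩⟩⟩
  obtain ⟨p, -, hp⟩ := LowerSemicontinuousOn.exists_isMinOn
    (s := (Set.univ : Set (S → stdSimplex ℝ (Fin n)))) Set.univ_nonempty isCompact_univ
    (hF.lowerSemicontinuousOn _)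
  exact ⟨p, le_antisymm (le_iInf fun q => hp (Set.mem_univ q)) (iInf_le _ p)⟩

theorem sumPI_attained {n : ℕ} (hn : 0 < n) {S : Set (Fin n → Bool)} (f : S → Bool) :
    ∃ p, sumPIObjective f p = sumPI f := by
  refine exists_eq_iInf hn _ ?_
  refine lowerSemicontinuous_iSup fun x => lowerSemicontinuous_iSup fun y =>
    lowerSemicontinuous_iSup fun _ => Continuous.lowerSemicontinuous ?_
  exact (continuous_finsetSum _ fun i _ => continuous_term x y i).inv

theorem maxPI_attained {n : ℕ} (hn : 0 < n) {S : Set (Fin n → Bool)} (f : S → Bool) :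
    ∃ p, maxPIObjective f p = maxPI f := by
  refine exists_eq_iInf hn _ ?_
  refine lowerSemicontinuous_iSup fun x => lowerSemicontinuous_iSup fun y =>
    lowerSemicontinuous_iSup fun _ => Continuous.lowerSemicontinuous ?_
  have h : Continuous fun p : S → stdSimplex ℝ (Fin n) =>
      (Finset.univ.filter fun i => x.1 i ≠ y.1 i).sup fun i =>
        ENNReal.ofReal √((p x).1 i * (p y).1 i) :=
    Continuous.finset_sup_apply fun i _ => continuous_term x y i
  have e : (fun p : S → stdSimplex ℝ (Fin n) =>
      (⨆ (i : Fin n) (_ : x.1 i ≠ y.1 i), ENNReal.ofReal √((p x).1 i * (p y).1 i))⁻¹) =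
      fun p => ((Finset.univ.filter fun i => x.1 i ≠ y.1 i).sup fun i =>
        ENNReal.ofReal √((p x).1 i * (p y).1 i))⁻¹ := by
    funext p
    simp [Finset.sup_eq_iSup]
  rw [e]
  exact h.inv

end AdvFormula

end

namespace AdvFormula

/-! The core is `maxPI_sq_le_card`. Given a partition into N rectangles, it suffices to attach label
distributions α_x, β_y with α_x(r) β_y(r) ≥ 1/N at every entry of label r, then push labels forward
to the coordinates that answer them. By minimax (`exists_mem_stdSimplex_le_sqrt_mul`) such α, β need
only work on average against each law μ on entries. Take the conditional laws of the label I given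
the row and given the column. By `one_div_sqrt_le_sum_mul_sqrt` it is enough that H(I|x) + H(I|y) ≤
log N. To see this, make row and column independent given I: the two entropies do not change, and by
the rectangle property I is still determined by the entry. The gap is then a relative entropy plus
log N − H(I), both nonnegative. The bound by formula size is the Karchmer–Wigderson argument: each
gate splits the rows or the columns between its subformulas. -/

/-! ### The conditional entropy inequality. -/

theorem exists_mem_stdSimplex_sum_mul_eq {ι : Type*} [Fintype ι] [Nonempty ι] (u : ι → ℝ)
    (hu : ∀ i, 0 ≤ u i) : ∃ α ∈ stdSimplex ℝ ι, ∀ i, (∑ j, u j) * α i = u i := by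
  classical
  by_cases h : ∑ j, u j = 0
  · refine ⟨_, single_mem_stdSimplex ℝ (Classical.arbitrary ι), fun i => ?_⟩
    rw [h, zero_mul, (Finset.sum_eq_zero_iff_of_nonneg fun j _ => hu j).1 h i (Finset.mem_univ i)]
  · refine ⟨fun i => u i / ∑ j, u j, ⟨fun i => div_nonneg (hu i) (Finset.sum_nonneg fun j _ => hu j),
      ?_⟩, fun i => by field_simp⟩
    rw [← Finset.sum_div, div_self h]

/-- With q = uv/w, the product abN factors as (q/(ps)) · (Nw), and log t ≥ 1 − 1/t applies to each
factor. The factor c will be the indicator of the correct label, so that the weights psc have total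
mass 1. -/
theorem two_mul_sub_le_mul_log {u v p s w a b c N : ℝ} (hu : 0 ≤ u) (hv : 0 ≤ v) (hN : 0 < N)
    (hp : 0 ≤ p) (hs : 0 ≤ s) (huw : u ≤ w) (ha : p * a = u) (hb : s * b = v)
    (hc : 0 ≤ c) (hc' : 0 < u → 0 < v → c = 1) :
    2 * (u * v / w) - p * s * c - u * v / w / (N * w) ≤
      u * v / w * (Real.log a + Real.log b + Real.log N) := by
  have hpsc : 0 ≤ p * s * c := by positivity
  rcases hu.eq_or_lt with rfl | hu
  · simp [hpsc]
  rcases hv.eq_or_lt with rfl | hv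
  · simp [hpsc]
  have hw : 0 < w := hu.trans_le huw
  have hp : 0 < p := hp.lt_of_ne (by rintro rfl; simp at ha; exact hu.ne ha)
  have hs : 0 < s := hs.lt_of_ne (by rintro rfl; simp at hb; exact hv.ne hb)
  have ha' : 0 < a := pos_of_mul_pos_right (ha ▸ hu) hp.le
  have hb' : 0 < b := pos_of_mul_pos_right (hb ▸ hv) hs.le
  rw [hc' hu hv, mul_one]
  set q := u * v / w with hq
  have hq0 : 0 < q := by positivity
  have e : Real.log a + Real.log b + Real.log N = Real.log (q / (p * s)) + Real.log (N * w) := by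
    rw [← Real.log_mul ha'.ne' hb'.ne', ← Real.log_mul (by positivity) hN.ne',
      ← Real.log_mul (by positivity) (by positivity), hq, ← ha, ← hb]
    congr 1
    field_simp
  have h1 := Real.one_sub_inv_le_log_of_pos (x := q / (p * s)) (by positivity)
  have h2 := Real.one_sub_inv_le_log_of_pos (x := N * w) (by positivity)
  calc 2 * q - p * s - q / (N * w) = q * ((1 - (q / (p * s))⁻¹) + (1 - (N * w)⁻¹)) := by
        field_simp
        ring
    _ ≤ _ := by
        rw [e]
        gcongr

/-- For a partition of `X × Y` into rectangles labelled by `ι` and a probability distribution on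
`X × Y`, the label's entropies conditional on the two sides add up to at most `log |ι|`. -/
theorem exists_mem_stdSimplex_sum_mul_log_nonneg {X Y ι : Type*} [Fintype X] [Fintype Y]
    [Fintype ι] [Nonempty ι] (r : X → Y → ι)
    (hr : ∀ x y x' y', r x y = r x' y' → r x y' = r x y) (μ : X → Y → ℝ)
    (hμ : ∀ x y, 0 ≤ μ x y) (hμ1 : ∑ x, ∑ y, μ x y = 1) :
    ∃ (α : X → ι → ℝ) (β : Y → ι → ℝ), (∀ x, α x ∈ stdSimplex ℝ ι) ∧
      (∀ y, β y ∈ stdSimplex ℝ ι) ∧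
      (∀ x y, 0 < μ x y → 0 < α x (r x y) ∧ 0 < β y (r x y)) ∧
      0 ≤ ∑ x, ∑ y, μ x y *
        (Real.log (α x (r x y)) + Real.log (β y (r x y)) + Real.log (Fintype.card ι)) := by
  classical
  -- `m` is the joint law of row, column and label; `u`, `v`, `w` are its marginals on (row, label),
  -- (column, label) and label.
  set m : X → Y → ι → ℝ := fun x y i => if r x y = i then μ x y else 0 with hm
  have hm0 : ∀ x y i, 0 ≤ m x y i := fun x y i => by
    simp only [hm]; split_ifs
    exacts [hμ x y, le_rfl]
  set u : X → ι → ℝ := fun x i => ∑ y, m x y i with hu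
  set v : Y → ι → ℝ := fun y i => ∑ x, m x y i with hv
  set w : ι → ℝ := fun i => ∑ x, u x i with hw
  have hwv : ∀ i, w i = ∑ y, v y i := fun i => Finset.sum_comm
  have hu0 : ∀ x i, 0 ≤ u x i := fun x i => Finset.sum_nonneg fun y _ => hm0 x y i
  have hv0 : ∀ y i, 0 ≤ v y i := fun y i => Finset.sum_nonneg fun x _ => hm0 x y i
  have huw : ∀ x i, u x i ≤ w i := fun x i =>
    Finset.single_le_sum (f := fun x => u x i) (fun x _ => hu0 x i) (Finset.mem_univ x)
  have hvw : ∀ y i, v y i ≤ w i := fun y i => by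
    rw [hwv]
    exact Finset.single_le_sum (f := fun y => v y i) (fun x _ => hv0 x i) (Finset.mem_univ y)
  have hw0 : ∀ i, 0 ≤ w i := fun i => Finset.sum_nonneg fun x _ => hu0 x i
  have hmi : ∀ x y, ∑ i, m x y i = μ x y := fun x y => by simp [hm]
  have hp : ∀ x, ∑ i, u x i = ∑ y, μ x y := fun x => by
    rw [hu, Finset.sum_comm]; simp only [hmi]
  have hs : ∀ y, ∑ i, v y i = ∑ x, μ x y := fun x => by
    rw [hv, Finset.sum_comm]; simp only [hmi]
  have hp1 : ∑ x, ∑ i, u x i = 1 := by simp only [hp, hμ1]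
  have hs1 : ∑ y, ∑ i, v y i = 1 := by simp only [hs]; rw [Finset.sum_comm, hμ1]
  have hw1 : ∑ i, w i = 1 := by rw [hw, Finset.sum_comm, hp1]
  choose α hα hαu using fun x => exists_mem_stdSimplex_sum_mul_eq (u x) (hu0 x)
  choose β hβ hβv using fun y => exists_mem_stdSimplex_sum_mul_eq (v y) (hv0 y)
  have hmu : ∀ x y, μ x y ≤ u x (r x y) := fun x y => by
    have := Finset.single_le_sum (f := fun y' => m x y' (r x y)) (fun y' _ => hm0 x y' _)
      (Finset.mem_univ y)
    simpa [hm] using this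
  have hmv : ∀ x y, μ x y ≤ v y (r x y) := fun x y => by
    have := Finset.single_le_sum (f := fun x' => m x' y (r x y)) (fun x' _ => hm0 x' y _)
      (Finset.mem_univ x)
    simpa [hm] using this
  refine ⟨α, β, hα, hβ, fun x y hxy => ⟨?_, ?_⟩, ?_⟩
  · exact pos_of_mul_pos_right ((hαu x (r x y)).symm ▸ hxy.trans_le (hmu x y))
      (Finset.sum_nonneg fun i _ => hu0 x i)
  · exact pos_of_mul_pos_right ((hβv y (r x y)).symm ▸ hxy.trans_le (hmv x y))
      (Finset.sum_nonneg fun i _ => hv0 y i)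
  set N : ℝ := (Fintype.card ι : ℝ) with hN
  have hNpos : 0 < N := by rw [hN]; exact_mod_cast Fintype.card_pos
  -- Row and column made conditionally independent given the label, keeping the marginals `u` and
  -- `v`.
  set q : X → Y → ι → ℝ := fun x y i => u x i * v y i / w i with hq
  have hqu : ∀ x i, ∑ y, q x y i = u x i := fun x i => by
    simp only [hq]
    rw [← Finset.sum_div, ← Finset.mul_sum, ← hwv]
    rcases (hw0 i).eq_or_lt with h | h
    · rw [← h, div_zero]; exact le_antisymm (hu0 x i) (h ▸ huw x i)
    · field_simp
  have hqv : ∀ y i, ∑ x, q x y i = v y i := fun y i => by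
    simp only [hq]
    rw [← Finset.sum_div, ← Finset.sum_mul]
    change w i * _ / _ = _
    rcases (hw0 i).eq_or_lt with h | h
    · rw [← h, div_zero]; exact le_antisymm (hv0 y i) (h ▸ hvw y i)
    · field_simp
  -- The rectangle property keeps `q` on triples whose label is the true one.
  have hsupp : ∀ x y i, 0 < u x i → 0 < v y i → r x y = i := fun x y i hx hy => by
    obtain ⟨y', -, hy'⟩ := Finset.exists_ne_zero_of_sum_ne_zero hx.ne'
    obtain ⟨x', -, hx'⟩ := Finset.exists_ne_zero_of_sum_ne_zero hy.ne'
    have e1 : r x y' = i := by by_contra h; simp [hm, h] at hy'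
    have e2 : r x' y = i := by by_contra h; simp [hm, h] at hx'
    rw [hr x y' x' y (e1.trans e2.symm), e1]
  have swap (k : X → Y → ι → ℝ) : ∑ x, ∑ y, ∑ i, k x y i = ∑ x, ∑ i, ∑ y, k x y i :=
    Finset.sum_congr rfl fun x _ => Finset.sum_comm
  have swap' (k : X → Y → ι → ℝ) : ∑ x, ∑ y, ∑ i, k x y i = ∑ y, ∑ i, ∑ x, k x y i := by
    rw [Finset.sum_comm]
    exact Finset.sum_congr rfl fun x _ => Finset.sum_comm
  -- The expected logarithm depends only on the marginals `u`, `v`, so `m` may be exchanged for `q`.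
  have expand (k : X → Y → ι → ℝ) (hku : ∀ x i, ∑ y, k x y i = u x i)
      (hkv : ∀ y i, ∑ x, k x y i = v y i) :
      ∑ x, ∑ y, ∑ i, k x y i * (Real.log (α x i) + Real.log (β y i) + Real.log N) =
        ∑ x, ∑ i, u x i * Real.log (α x i) + ∑ y, ∑ i, v y i * Real.log (β y i) + Real.log N := by
    simp only [mul_add, Finset.sum_add_distrib]
    rw [swap, swap' fun x y i => k x y i * Real.log (β y i), swap fun x y i => k x y i * Real.log N]
    simp only [← Finset.sum_mul, hku, hkv, hp1, one_mul]
  have lhs : ∑ x, ∑ y, μ x y *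
      (Real.log (α x (r x y)) + Real.log (β y (r x y)) + Real.log N) =
      ∑ x, ∑ y, ∑ i, m x y i * (Real.log (α x i) + Real.log (β y i) + Real.log N) := by
    simp [hm]
  rw [lhs, expand m (fun _ _ => rfl) (fun _ _ => rfl), ← expand q hqu hqv]
  have key : ∑ x, ∑ y, ∑ i, (2 * q x y i -
      (∑ j, u x j) * (∑ j, v y j) * (if r x y = i then 1 else 0) - q x y i / (N * w i)) ≤
      ∑ x, ∑ y, ∑ i, q x y i * (Real.log (α x i) + Real.log (β y i) + Real.log N) := by
    refine Finset.sum_le_sum fun x _ => Finset.sum_le_sum fun y _ => Finset.sum_le_sum fun i _ => ?_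
    exact two_mul_sub_le_mul_log (hu0 x i) (hv0 y i) hNpos (Finset.sum_nonneg fun j _ => hu0 x j)
      (Finset.sum_nonneg fun j _ => hv0 y j) (huw x i) (hαu x i) (hβv y i)
      (by split_ifs <;> norm_num) (fun h h' => if_pos (hsupp x y i h h'))
  refine le_trans ?_ key
  simp only [Finset.sum_sub_distrib]
  have t1 : ∑ x, ∑ y, ∑ i, 2 * q x y i = 2 := by
    rw [swap]; simp only [← Finset.mul_sum, hqu, hp1, mul_one]
  have t2 : ∑ x, ∑ y, ∑ i, (∑ j, u x j) * (∑ j, v y j) * (if r x y = i then (1 : ℝ) else 0) = 1 := by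
    simp [← Finset.mul_sum, hs1, hp1]
  -- Only an inequality: a label of mass 0 contributes 0 instead of 1/N.
  have t3 : ∑ x, ∑ y, ∑ i, q x y i / (N * w i) ≤ 1 := by
    rw [swap]; simp only [← Finset.sum_div, hqu]
    rw [Finset.sum_comm]; simp only [← Finset.sum_div]
    calc ∑ i, (∑ x, u x i) / (N * w i) ≤ ∑ i : ι, 1 / N := by
          refine Finset.sum_le_sum fun i _ => ?_
          change w i / (N * w i) ≤ _
          rcases (hw0 i).eq_or_lt with h | h
          · rw [← h, zero_div]; positivity
          · apply le_of_eq; field_simp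
      _ = 1 := by simp [← hN, hNpos.ne']
  linarith

/-! ### From averages to all entries by minimax. -/

/-- Average √(abN) ≥ 1 + log(abN)/2 over `μ`. -/
theorem one_div_sqrt_le_sum_mul_sqrt {A : Type*} [Fintype A] {μ a b : A → ℝ} {N : ℝ} (hN : 0 < N)
    (hμ : μ ∈ stdSimplex ℝ A) (hab : ∀ t, 0 < μ t → 0 < a t ∧ 0 < b t)
    (h : 0 ≤ ∑ t, μ t * (Real.log (a t) + Real.log (b t) + Real.log N)) :
    1 / √N ≤ ∑ t, μ t * √(a t * b t) := by
  have hN' : 0 < √N := Real.sqrt_pos.2 hN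
  rw [div_le_iff₀ hN', Finset.sum_mul]
  have key : ∑ t, (μ t + μ t * (Real.log (a t) + Real.log (b t) + Real.log N) / 2) ≤
      ∑ t, μ t * √(a t * b t) * √N := by
    refine Finset.sum_le_sum fun t _ => ?_
    rcases (hμ.1 t).eq_or_lt with h0 | h0
    · simp [← h0]
    obtain ⟨ha, hb⟩ := hab t h0
    have := Real.log_le_sub_one_of_pos (x := √(a t * b t * N)) (by positivity)
    rw [Real.log_sqrt (by positivity), Real.log_mul (by positivity) hN.ne',
      Real.log_mul ha.ne' hb.ne', Real.sqrt_mul (by positivity)] at this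
    nlinarith
  rw [Finset.sum_add_distrib, ← Finset.sum_div, hμ.2] at key
  linarith

/-- Joint concavity of the geometric mean: after squaring, the gap is st(√(ad) − √(bc))². -/
theorem add_mul_sqrt_le_sqrt_add_mul_add {a b c d s t : ℝ} (ha : 0 ≤ a) (hb : 0 ≤ b) (hc : 0 ≤ c)
    (hd : 0 ≤ d) (hs : 0 ≤ s) (ht : 0 ≤ t) :
    s * √(a * b) + t * √(c * d) ≤ √((s * a + t * c) * (s * b + t * d)) := by
  apply Real.le_sqrt_of_sq_le
  rw [Real.sqrt_mul ha, Real.sqrt_mul hc]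
  have h1 := Real.sq_sqrt ha
  have h2 := Real.sq_sqrt hb
  have h3 := Real.sq_sqrt hc
  have h4 := Real.sq_sqrt hd
  generalize √a = A at *
  generalize √b = B at *
  generalize √c = C at *
  generalize √d = D at *
  subst h1 h2 h3 h4
  nlinarith [mul_nonneg (mul_nonneg hs ht) (sq_nonneg (A * D - C * B))]

/-- For a partition of `X × Y` into rectangles labelled by `ι` there are distributions on the
labels, attached to the rows and to the columns, that give the label of every entry a product of
probabilities at least `1 / |ι|`. -/
theorem exists_mem_stdSimplex_le_sqrt_mul {X Y ι : Type*} [Fintype X] [Fintype Y] [Fintype ι]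
    [Nonempty X] [Nonempty Y] (r : X → Y → ι)
    (hr : ∀ x y x' y', r x y = r x' y' → r x y' = r x y) :
    ∃ (α : X → ι → ℝ) (β : Y → ι → ℝ), (∀ x, α x ∈ stdSimplex ℝ ι) ∧
      (∀ y, β y ∈ stdSimplex ℝ ι) ∧
      ∀ x y, 1 / √(Fintype.card ι) ≤ √(α x (r x y) * β y (r x y)) := by
  classical
  have : Nonempty ι := ⟨r (Classical.arbitrary X) (Classical.arbitrary Y)⟩
  let K : Set ((X → ι → ℝ) × (Y → ι → ℝ)) :=
    (Set.univ.pi fun _ => stdSimplex ℝ ι) ×ˢ (Set.univ.pi fun _ => stdSimplex ℝ ι)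
  let F : (X × Y → ℝ) → (X → ι → ℝ) × (Y → ι → ℝ) → ℝ := fun μ k =>
    ∑ t, μ t * √(k.1 t.1 (r t.1 t.2) * k.2 t.2 (r t.1 t.2))
  have hKc : Convex ℝ K := (convex_pi fun _ _ => convex_stdSimplex ℝ ι).prod
    (convex_pi fun _ _ => convex_stdSimplex ℝ ι)
  have hKk : IsCompact K := (isCompact_univ_pi fun _ => isCompact_stdSimplex ℝ ι).prod
    (isCompact_univ_pi fun _ => isCompact_stdSimplex ℝ ι)
  have hne : (stdSimplex ℝ ι).Nonempty := ⟨_, single_mem_stdSimplex ℝ (Classical.arbitrary ι)⟩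
  have hKn : K.Nonempty := (Set.univ_pi_nonempty_iff.2 fun _ => hne).prod
    (Set.univ_pi_nonempty_iff.2 fun _ => hne)
  -- `F` is linear in the law `μ`, which minimizes, and concave in the pair of families, which
  -- maximizes.
  obtain ⟨μ, hμ, k, hk, hsp⟩ := Sion.exists_isSaddlePointOn (X := stdSimplex ℝ (X × Y)) (Y := K)
    (f := F) ⟨_, single_mem_stdSimplex ℝ (Classical.arbitrary (X × Y))⟩
    (convex_stdSimplex ℝ _) (isCompact_stdSimplex ℝ _)
    (fun k _ => Continuous.continuousOn (by fun_prop) |>.lowerSemicontinuousOn)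
    (fun k _ => ConvexOn.quasiconvexOn ⟨convex_stdSimplex ℝ _, fun μ _ ν _ s t _ _ _ => by
      simp only [F, Pi.add_apply, Pi.smul_apply, smul_eq_mul, Finset.mul_sum, add_mul, mul_assoc,
        Finset.sum_add_distrib, le_refl]⟩)
    hKc hKn hKk
    (fun μ _ => Continuous.continuousOn (by fun_prop) |>.upperSemicontinuousOn)
    (fun μ hμ => ConcaveOn.quasiconcaveOn ⟨hKc, fun k hk l hl s t hs ht _ => by
      simp only [F, smul_eq_mul, Finset.mul_sum, ← Finset.sum_add_distrib]
      refine Finset.sum_le_sum fun z _ => ?_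
      have := add_mul_sqrt_le_sqrt_add_mul_add ((hk.1 z.1 trivial).1 (r z.1 z.2))
        ((hk.2 z.2 trivial).1 (r z.1 z.2)) ((hl.1 z.1 trivial).1 (r z.1 z.2))
        ((hl.2 z.2 trivial).1 (r z.1 z.2)) hs ht
      have := mul_le_mul_of_nonneg_left this (hμ.1 z)
      simp only [Prod.fst_add, Prod.snd_add, Prod.smul_fst, Prod.smul_snd, Pi.add_apply,
        Pi.smul_apply, smul_eq_mul]
      linarith⟩)
  refine ⟨k.1, k.2, fun x => hk.1 x trivial, fun y => hk.2 y trivial, fun x y => ?_⟩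
  obtain ⟨α, β, hα, hβ, hpos, hlog⟩ := exists_mem_stdSimplex_sum_mul_log_nonneg r hr
    (fun x y => μ (x, y)) (fun x y => hμ.1 _) (by rw [← Fintype.sum_prod_type', hμ.2])
  rw [← Fintype.sum_prod_type'] at hlog
  have h1 : 1 / √(Fintype.card ι) ≤ F μ (α, β) :=
    one_div_sqrt_le_sum_mul_sqrt (by exact_mod_cast Fintype.card_pos) hμ
      (fun t ht => hpos t.1 t.2 ht) hlog
  -- At the point mass on (x, y), `F` is the value of the single entry, so the saddle point turns
  -- the average bound into a pointwise one.
  have h2 := hsp _ (single_mem_stdSimplex ℝ (x, y)) (α, β) ⟨fun x _ => hα x, fun y _ => hβ y⟩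
  refine h1.trans (h2.trans (le_of_eq ?_))
  simp [F, Pi.single_apply]

/-! ### `sumPI`, `maxPI` and rectangle partitions. -/

theorem sumPIObjective_le_maxPIObjective {n : ℕ} {S : Set (Fin n → Bool)} (f : S → Bool)
    (p : S → stdSimplex ℝ (Fin n)) : sumPIObjective f p ≤ maxPIObjective f p := by
  refine iSup_mono fun x => iSup_mono fun y => iSup_mono fun _ => ENNReal.inv_le_inv.2 ?_
  exact iSup₂_le fun i hi => Finset.single_le_sum
    (f := fun i => ENNReal.ofReal √((p x).1 i * (p y).1 i)) (fun _ _ => zero_le)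
    (Finset.mem_filter.2 ⟨Finset.mem_univ i, hi⟩)

theorem sumPI_le_maxPI {n : ℕ} {S : Set (Fin n → Bool)} (f : S → Bool) : sumPI f ≤ maxPI f :=
  iInf_mono (sumPIObjective_le_maxPIObjective f)

/-- Pushing a distribution on `ι` forward along `z : ι → κ`. -/
theorem exists_mem_stdSimplex_apply_le {ι κ : Type*} [Fintype ι] [Fintype κ] (z : ι → κ)
    {α : ι → ℝ} (hα : α ∈ stdSimplex ℝ ι) :
    ∃ q : stdSimplex ℝ κ, ∀ i, α i ≤ q.1 (z i) := by
  classical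
  refine ⟨⟨fun k => ∑ i with z i = k, α i, fun k => Finset.sum_nonneg fun i _ => hα.1 i, ?_⟩,
    fun i => ?_⟩
  · exact (Finset.sum_fiberwise _ _ _).trans hα.2
  · exact Finset.single_le_sum (fun i _ => hα.1 i)
      (Finset.mem_filter.2 ⟨Finset.mem_univ i, rfl⟩)

theorem maxPI_sq_le_card {n : ℕ} (hn : 0 < n) {S : Set (Fin n → Bool)} (f : S → Bool)
    (P : Finset (Set ({x : S // f x = false} × {y : S // f y = true})))
    (hP : IsMonochromaticPartition (kwRelation f) P) : maxPI f ^ 2 ≤ (P.card : ℝ≥0∞) := by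
  classical
  obtain ⟨hrect, hdisj, hcover⟩ := hP
  have : Nonempty (stdSimplex ℝ (Fin n)) := ⟨⟨_, single_mem_stdSimplex ℝ ⟨0, hn⟩⟩⟩
  by_cases hne : Nonempty {x : S // f x = false} ∧ Nonempty {y : S // f y = true}
  swap
  · have h0 : maxPI f = 0 := by
      refine le_antisymm ((iInf_le _ (Classical.arbitrary _)).trans ?_) zero_le
      refine iSup_le fun x => iSup_le fun y => iSup_le fun h => (hne ?_).elim
      cases hx : f x <;> cases hy : f y
      · exact absurd (hx.trans hy.symm) h
      · exact ⟨⟨⟨x, hx⟩⟩, ⟨⟨y, hy⟩⟩⟩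
      · exact ⟨⟨⟨y, hy⟩⟩, ⟨⟨x, hx⟩⟩⟩
      · exact absurd (hx.trans hy.symm) h
    simp [h0]
  obtain ⟨hX, hY⟩ := hne
  choose r hrP hr using fun a => hcover a
  have hmem (a) {Q} (hQ : Q ∈ P) (ha : a ∈ Q) : r a = Q := by
    by_contra h
    exact (hdisj _ (hrP a) _ hQ h).le_bot ⟨hr a, ha⟩
  choose X' Y' hXY z hz using fun Q : P => hrect Q.1 Q.2
  let r' : {x : S // f x = false} → {y : S // f y = true} → P := fun x y => ⟨r (x, y), hrP _⟩
  have hmem' (x y) : x ∈ X' (r' x y) ∧ y ∈ Y' (r' x y) := by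
    have h : (x, y) ∈ (r' x y).1 := hr (x, y)
    rw [hXY] at h
    exact h
  -- If (x, y) and (x', y') share a rectangle, it contains (x, y'), and disjointness makes it the
  -- label there.
  obtain ⟨α, β, hα, hβ, h⟩ := exists_mem_stdSimplex_le_sqrt_mul r' fun x y x' y' e => by
    apply Subtype.ext
    refine hmem _ (r' x y).2 ?_
    rw [hXY]
    exact ⟨(hmem' x y).1, e ▸ (hmem' x' y').2⟩
  rw [Fintype.card_coe] at h
  choose a ha using fun x => exists_mem_stdSimplex_apply_le z (hα x)
  choose b hb using fun y => exists_mem_stdSimplex_apply_le z (hβ y)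
  let p : S → stdSimplex ℝ (Fin n) := fun x =>
    if hx : f x = false then a ⟨x, hx⟩ else b ⟨x, by simpa using hx⟩
  have hpX (x : {x : S // f x = false}) : p x.1 = a x := dif_pos x.2
  have hpY (y : {y : S // f y = true}) : p y.1 = b y := dif_neg (by simp [y.2])
  have hcard : 0 < (P.card : ℝ) := by
    exact_mod_cast Finset.card_pos.2 ⟨_, hrP (Classical.arbitrary _)⟩
  have hs : 0 < √(P.card : ℝ) := Real.sqrt_pos.2 hcard
  have main (x : {x : S // f x = false}) (y : {y : S // f y = true}) :
      ∃ i, x.1.1 i ≠ y.1.1 i ∧ 1 / √(P.card : ℝ) ≤ √((p x.1).1 i * (p y.1).1 i) := by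
    -- The coordinate answering the rectangle of (x, y) receives at least the mass of that label on
    -- both sides.
    refine ⟨z (r' x y), hz _ _ (hmem' x y).1 _ (hmem' x y).2, (h x y).trans (Real.sqrt_le_sqrt ?_)⟩
    rw [hpX, hpY]
    exact mul_le_mul (ha _ _) (hb _ _) ((hβ y).1 _) ((a x).2.1 _)
  have main' (x y : S) (hxy : f x ≠ f y) :
      ∃ i, x.1 i ≠ y.1 i ∧ 1 / √(P.card : ℝ) ≤ √((p x).1 i * (p y).1 i) := by
    cases hx : f x <;> cases hy : f y
    · exact absurd (hx.trans hy.symm) hxy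
    · exact main ⟨x, hx⟩ ⟨y, hy⟩
    · obtain ⟨i, hi, h⟩ := main ⟨y, hy⟩ ⟨x, hx⟩
      exact ⟨i, hi.symm, by rwa [mul_comm]⟩
    · exact absurd (hx.trans hy.symm) hxy
  have hle : maxPI f ≤ ENNReal.ofReal √(P.card : ℝ) := by
    refine (iInf_le _ p).trans (iSup_le fun x => iSup_le fun y => iSup_le fun hxy => ?_)
    obtain ⟨i, hi, h⟩ := main' x y hxy
    rw [ENNReal.inv_le_iff_inv_le, ← ENNReal.ofReal_inv_of_pos hs, ← one_div]
    exact (ENNReal.ofReal_le_ofReal h).trans (le_iSup₂_of_le i hi le_rfl)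
  calc maxPI f ^ 2 ≤ ENNReal.ofReal √(P.card : ℝ) ^ 2 := by gcongr
    _ = (P.card : ℝ≥0∞) := by
      rw [← ENNReal.ofReal_pow hs.le, Real.sq_sqrt hcard.le, ENNReal.ofReal_natCast]

/-! ### From formulas to rectangle partitions. -/

theorem exists_union_rectangles {X Y Z : Type*} {R : X → Y → Z → Prop} {A B : Set (X × Y)}
    (hAB : Disjoint A B) {k l : ℕ}
    (hA : ∃ P : Finset (Set (X × Y)), (∀ Q ∈ P, IsMonochromaticRectangle R Q ∧ Q ⊆ A) ∧
      (∀ Q ∈ P, ∀ Q' ∈ P, Q ≠ Q' → Disjoint Q Q') ∧ (∀ a ∈ A, ∃ Q ∈ P, a ∈ Q) ∧ P.card ≤ k)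
    (hB : ∃ P : Finset (Set (X × Y)), (∀ Q ∈ P, IsMonochromaticRectangle R Q ∧ Q ⊆ B) ∧
      (∀ Q ∈ P, ∀ Q' ∈ P, Q ≠ Q' → Disjoint Q Q') ∧ (∀ a ∈ B, ∃ Q ∈ P, a ∈ Q) ∧ P.card ≤ l) :
    ∃ P : Finset (Set (X × Y)), (∀ Q ∈ P, IsMonochromaticRectangle R Q ∧ Q ⊆ A ∪ B) ∧
      (∀ Q ∈ P, ∀ Q' ∈ P, Q ≠ Q' → Disjoint Q Q') ∧ (∀ a ∈ A ∪ B, ∃ Q ∈ P, a ∈ Q) ∧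
      P.card ≤ k + l := by
  classical
  obtain ⟨P, hP1, hP2, hP3, hP4⟩ := hA
  obtain ⟨P', hP1', hP2', hP3', hP4'⟩ := hB
  refine ⟨P ∪ P', ?_, ?_, ?_, (Finset.card_union_le _ _).trans (add_le_add hP4 hP4')⟩
  · intro Q hQ
    rcases Finset.mem_union.1 hQ with h | h
    · exact ⟨(hP1 Q h).1, (hP1 Q h).2.trans Set.subset_union_left⟩
    · exact ⟨(hP1' Q h).1, (hP1' Q h).2.trans Set.subset_union_right⟩
  · intro Q hQ Q' hQ' hne
    rcases Finset.mem_union.1 hQ with h | h <;> rcases Finset.mem_union.1 hQ' with h' | h'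
    · exact hP2 Q h Q' h' hne
    · exact hAB.mono (hP1 Q h).2 (hP1' Q' h').2
    · exact (hAB.mono (hP1 Q' h').2 (hP1' Q h).2).symm
    · exact hP2' Q h Q' h' hne
  · rintro a (ha | ha)
    · obtain ⟨Q, hQ, haQ⟩ := hP3 a ha
      exact ⟨Q, Finset.mem_union_left _ hQ, haQ⟩
    · obtain ⟨Q, hQ, haQ⟩ := hP3' a ha
      exact ⟨Q, Finset.mem_union_right _ hQ, haQ⟩

/-- A formula that is false on `X'` and true on `Y'` yields a partition of `X' × Y'` into
monochromatic rectangles, at most one for each leaf. -/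
theorem Formula.exists_rectangles {n : ℕ} {S : Set (Fin n → Bool)} (f : S → Bool)
    (φ : Formula n) (X' : Set {x : S // f x = false}) (Y' : Set {y : S // f y = true})
    (hX : ∀ x ∈ X', φ.eval x.1 = false) (hY : ∀ y ∈ Y', φ.eval y.1 = true) :
    ∃ P : Finset (Set ({x : S // f x = false} × {y : S // f y = true})),
      (∀ Q ∈ P, IsMonochromaticRectangle (kwRelation f) Q ∧ Q ⊆ X' ×ˢ Y') ∧
      (∀ Q ∈ P, ∀ Q' ∈ P, Q ≠ Q' → Disjoint Q Q') ∧ (∀ a ∈ X' ×ˢ Y', ∃ Q ∈ P, a ∈ Q) ∧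
      P.card ≤ φ.size := by
  induction φ generalizing X' Y' with
  | pos i =>
    refine ⟨{X' ×ˢ Y'}, ?_, ?_, ?_, by simp [Formula.size]⟩
    · simp only [Finset.mem_singleton, forall_eq, subset_refl, and_true]
      refine ⟨X', Y', rfl, i, fun x hx y hy => ?_⟩
      have h1 := hX x hx
      have h2 := hY y hy
      simp only [Formula.eval] at h1 h2
      simp [kwRelation, h1, h2]
    · simp
    · simp
  | neg i =>
    refine ⟨{X' ×ˢ Y'}, ?_, ?_, ?_, by simp [Formula.size]⟩
    · simp only [Finset.mem_singleton, forall_eq, subset_refl, and_true]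
      refine ⟨X', Y', rfl, i, fun x hx y hy => ?_⟩
      have h1 := hX x hx
      have h2 := hY y hy
      simp only [Formula.eval, Bool.not_eq_eq_eq_not, Bool.not_true, Bool.not_false] at h1 h2
      simp [kwRelation, h1, h2]
    · simp
    · simp
  | and φ ψ ihφ ihψ =>
    simp only [Formula.eval, Bool.and_eq_true, Bool.and_eq_false_iff] at hX hY
    -- Rows where `φ` is false go to `φ`; on the remaining rows `ψ` must be false. Dually, an `or`
    -- gate splits the columns.
    have e : X' ×ˢ Y' = (X' ∩ {x | φ.eval x.1 = false}) ×ˢ Y' ∪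
        (X' \ {x | φ.eval x.1 = false}) ×ˢ Y' := by
      rw [← Set.union_prod, Set.inter_union_sdiff]
    rw [e]
    refine exists_union_rectangles (Set.disjoint_prod.2 (.inl Set.disjoint_sdiff_inter.symm))
      (ihφ _ _ (fun x hx => hx.2) fun y hy => (hY y hy).1)
      (ihψ _ _ (fun x hx => (hX x hx.1).resolve_left hx.2) fun y hy => (hY y hy).2)
  | or φ ψ ihφ ihψ =>
    simp only [Formula.eval, Bool.or_eq_true, Bool.or_eq_false_iff] at hX hY
    have e : X' ×ˢ Y' = X' ×ˢ (Y' ∩ {y | φ.eval y.1 = true}) ∪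
        X' ×ˢ (Y' \ {y | φ.eval y.1 = true}) := by
      rw [← Set.prod_union, Set.inter_union_sdiff]
    rw [e]
    refine exists_union_rectangles (Set.disjoint_prod.2 (.inr Set.disjoint_sdiff_inter.symm))
      (ihφ _ _ (fun x hx => (hX x hx).1) fun y hy => hy.2)
      (ihψ _ _ (fun x hx => (hX x hx).2) fun y hy => (hY y hy.1).resolve_left hy.2)

theorem rectanglePartitionNumber_kwRelation_le {n : ℕ} {S : Set (Fin n → Bool)} (f : S → Bool) :
    rectanglePartitionNumber (kwRelation f) ≤ formulaSize f := by
  refine le_iInf₂ fun φ hφ => ?_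
  obtain ⟨P, h1, h2, h3, h4⟩ := φ.exists_rectangles f Set.univ Set.univ
    (fun x _ => (hφ x.1).trans x.2) (fun y _ => (hφ y.1).trans y.2)
  exact (iInf₂_le P ⟨fun Q hQ => (h1 Q hQ).1, h2, fun a => h3 a ⟨trivial, trivial⟩⟩).trans
    (by exact_mod_cast h4)

theorem maxPI_sq_le_rectanglePartitionNumber {n : ℕ} (hn : 0 < n) {S : Set (Fin n → Bool)}
    (f : S → Bool) :
    maxPI f ^ 2 ≤ ((rectanglePartitionNumber (kwRelation f) : ℕ∞) : ℝ≥0∞) := by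
  unfold rectanglePartitionNumber
  simp only [ENat.toENNReal_iInf]
  exact le_iInf₂ fun P hP => by simpa using maxPI_sq_le_card hn f P hP

end AdvFormula

theorem mainTheorem1 (n : ℕ) (hn : 0 < n) (S : Set (Fin n → Bool)) (f : S → Bool) :
    AdvFormula.sumPI f ^ 2 ≤ AdvFormula.maxPI f ^ 2 ∧
      AdvFormula.maxPI f ^ 2 ≤
        ((AdvFormula.rectanglePartitionNumber (AdvFormula.kwRelation f) : ℕ∞) : ENNReal) ∧
      AdvFormula.rectanglePartitionNumber (AdvFormula.kwRelation f) ≤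
        AdvFormula.formulaSize f :=
  ⟨pow_le_pow_left' (AdvFormula.sumPI_le_maxPI f) 2,
    AdvFormula.maxPI_sq_le_rectanglePartitionNumber hn f,
    AdvFormula.rectanglePartitionNumber_kwRelation_le f⟩
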